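/- Theorem 1 (Lower bound). Let $n\to\infty$, let $\sigma\in\{\pm1\}^n$ be an unknown label vector, and suppose that one observes a symmetric random matrix $A\in\mathbb{R}^{n\times n}$ whose entries $A_{ij}$, $i\le j$, are independent, with one of the following laws: - Z2 synchronization: $A_{ij}\sim N(\sigma_i\sigma_j,\tau^2)$, where $\tau=\tau_n>0$ may depend on $n$. Put $I^*=(2\tau^2)^{-1}$, $\bar n=n$, $\Theta(n)=\{\pm1\}^n$. - Censored block model (CBM): $A_{ij}$ equals $\sigma_i\sigma_j$, $-\sigma_i\sigma_j$, $0$ with probabilities $\alpha(1-\epsilon)$, $\alpha\epsilon$, $1-\alpha$ respectively, where $\alpha=\alpha_n\in(0,1]$ may depend on $n$ and $\epsilon\in(0,\tfrac12)$ is a constant. Put $I^*=\big(\sqrt{\alpha(1-\epsilon)}-\sqrt{\alpha\epsilon}\big)^2$, $\bar n=n$, $\Theta(n)=\{\pm1\}^n$. - Binary stochastic block model (SBM): $A_{ij}\sim\mathrm{Ber}(p)$ if $\sigma_i\sigma_j=1$ and $A_{ij}\sim\mathrm{Ber}(q)$ if $\sigma_i\sigma_j=-1$, where $0<q<p<1$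 may depend on $n$. Put $I^*=-2\log\big[\sqrt{pq}+\sqrt{(1-p)(1-q)}\big]$, $\bar n=n/2$, and $\Theta(n)=\big\{\sigma\in\{\pm1\}^n:\ \#\{i:\sigma_i=1\}\in[\tfrac{n}{2\beta},\tfrac{n\beta}{2}]\big\}$, where $\beta=\beta_n$ is any number larger than $1+C/n$ and $C>0$ is a large enough numerical constant. For $\sigma,\sigma'\in\{\pm1\}^n$ let $\mathrm{err}(\sigma,\sigma')=\min_{g\in\{\pm1\}}\frac1n\sum_{i=1}^n\mathbb{I}\{g\sigma_i\ne\sigma'_i\}$. Then for any constant $c_0\in(0,1)$ the following holds for Z2, for CBM with $I^*=o(1)$, and for SBM with $0<q<p<1-c_0$: if $nI^*\to\infty$ as $n\to\infty$, then $$\inf_{\hat\sigma}\ \sup_{\sigma\in\Theta(n)}\ \mathbb{E}_\sigma\,\mathrm{err}(\hat\sigma,\sigma)\ \ge\ \exp\big[-(1+o(1))\,\bar n I^*\big]$$ for all sufficiently large $n$, where the infimum is over all estimators $\hat\sigma$ (measurable functions of $A$ with values in $\{\pm1\}^n$) and $\mathbb{E}_\sigma$ is the expectation when $\sigma$ is the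 ground truth. -/

import Mathlib

open MeasureTheory ProbabilityTheory Filter Topology

noncomputable section

namespace BlockModel

/-- Vectors of cluster labels in `{±1}ⁿ`. -/
abbrev Label (n : ℕ) : Type := Fin n → ℤˣ

/-- The index set `{(i, j) : i ≤ j}` of the entries on and above the diagonal. -/
abbrev UpperIdx (n : ℕ) : Type := {e : Fin n × Fin n // e.1 ≤ e.2}

/-- The symmetric matrix with prescribed entries on and above the diagonal. -/
def symmMatrix {n : ℕ} (a : UpperIdx n → ℝ) : Fin n → Fin n → ℝ := fun i j =>
  if h : i ≤ j then a ⟨(i, j), h⟩ else a ⟨(j, i), le_of_not_ge h⟩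

/-- The law of the observed matrix when the ground truth is `σ`: the matrix is symmetric and its
entries `(i, j)` with `i ≤ j` are independent, the entry `(i, j)` having law
`entryLaw (σ i * σ j)`. -/
def obsLaw {n : ℕ} (entryLaw : ℤˣ → Measure ℝ) (σ : Label n) : Measure (Fin n → Fin n → ℝ) :=
  (Measure.pi fun e : UpperIdx n => entryLaw (σ e.1.1 * σ e.1.2)).map symmMatrix

/-- The fraction of nodes with different labels under `σ` and `σ'`, minimized over a global
flipping of signs. -/
def err {n : ℕ} (σ σ' : Label n) : ℝ :=
  Finset.univ.inf' Finset.univ_nonempty fun g : ℤˣ =>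
    1 / (n : ℝ) * ∑ i : Fin n, if g * σ i ≠ σ' i then (1 : ℝ) else 0

/-- Estimators of the ground truth: measurable functions of the observed matrix. -/
abbrev Estimator (n : ℕ) : Type := {f : (Fin n → Fin n → ℝ) → Label n // Measurable f}

/-- The expected misclustering error of an estimator when the ground truth is `σ`. -/
def risk {n : ℕ} (entryLaw : ℤˣ → Measure ℝ) (f : Estimator n) (σ : Label n) : ℝ :=
  ∫ A, err (f.1 A) σ ∂(obsLaw entryLaw σ)

/-- The minimax risk: infimum over all estimators of the worst-case risk over `Θ`. -/
def minimaxRisk {n : ℕ} (entryLaw : ℤˣ → Measure ℝ) (Θ : Set (Label n)) : ℝ :=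
  ⨅ f : Estimator n, ⨆ σ : Θ, risk entryLaw f σ

/-! ### Entry laws; the argument `s` is the product of the labels of the two nodes -/

/-- `ℤ₂` synchronization: `N(s, τ²)`. -/
def z2Law (τ : ℝ) (s : ℤˣ) : Measure ℝ := gaussianReal ((s : ℤ) : ℝ) (Real.toNNReal (τ ^ 2))

/-- Censored block model: `s` with probability `α (1 - ε)`, `-s` with probability `α ε`,
and `0` with probability `1 - α`. -/
def cbmLaw (α ε : ℝ) (s : ℤˣ) : Measure ℝ :=
  ENNReal.ofReal (α * (1 - ε)) • Measure.dirac ((s : ℤ) : ℝ) +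
    ENNReal.ofReal (α * ε) • Measure.dirac (-((s : ℤ) : ℝ)) +
    ENNReal.ofReal (1 - α) • Measure.dirac 0

/-- Stochastic block model: `Ber(p)` if `s = 1` and `Ber(q)` if `s = -1`. -/
def sbmLaw (p q : unitInterval) (s : ℤˣ) : Measure ℝ :=
  if s = 1 then bernoulliMeasure 1 0 p else bernoulliMeasure 1 0 q

/-! ### Signal-to-noise ratios -/

def z2SNR (τ : ℝ) : ℝ := (2 * τ ^ 2)⁻¹

def cbmSNR (α ε : ℝ) : ℝ := (√(α * (1 - ε)) - √(α * ε)) ^ 2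

def sbmSNR (p q : ℝ) : ℝ := -2 * Real.log (√(p * q) + √((1 - p) * (1 - q)))

/-- The parameter space of the stochastic block model: the number of labels `1` lies in
`[n / (2β), nβ / 2]`. -/
def sbmParamSpace (n : ℕ) (β : ℝ) : Set (Label n) :=
  {σ | (((Finset.univ.filter fun i => σ i = 1).card : ℕ) : ℝ) ∈
    Set.Icc ((n : ℝ) / (2 * β)) ((n : ℝ) * β / 2)}

end BlockModel

end

noncomputable section

namespace BlockModel

/-! The hard instances are single-label flips. Changing the label of node `i` alters only the laws
of the `n - 1` off-diagonal entries in its row. For each of these the two candidate laws are `B *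
exp h` and `B * exp (-h)` times a common `r`, the normalized geometric mean, where `B` is their
Bhattacharyya coefficient (`IsExpTilt`). On the product space the two error probabilities therefore
add up to at least `B ^ (n - 1)` times the mean of `exp (-|H|)`, with `H` the signed sum of the
`h`'s, hence to at least `B ^ (n - 1) * exp (-√(E H²))` (`prod_exp_neg_le_add_compl`). When the
other labels are nearly balanced, the means of the summands nearly cancel
(`le_obsLaw_add_obsLaw_flip`). Then `E H²` is `O(n I*)`, its root is `o(n I*)`, and `B ^ n` supplies
the claimed exponent.

An Assouad-type averaging passes to the minimax risk (`le_minimaxRisk`). The labels outside a set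
`S` of at most `n / 3` nodes are fixed, which removes the global sign ambiguity. The errors on `S`
are averaged over a family of nearly balanced vectors, each of which has a constant fraction of
flips staying in the family. The constant factor lost is absorbed into the `o(1)` because `n I* →
∞`. -/

/-- A finite product of measures with densities has the product density. -/
lemma pi_withDensity {ι : Type*} [Fintype ι] {Ω : ι → Type*} [∀ i, MeasurableSpace (Ω i)]
    (ν : ∀ i, Measure (Ω i)) [∀ i, IsProbabilityMeasure (ν i)] (f : ∀ i, Ω i → ENNReal)
    (hf : ∀ i, Measurable (f i)) [∀ i, SigmaFinite ((ν i).withDensity (f i))] :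
    Measure.pi (fun i => (ν i).withDensity (f i)) =
      (Measure.pi ν).withDensity fun x => ∏ i, f i (x i) := by
  refine Measure.pi_eq fun s hs => ?_
  have hg : ∀ i, Measurable ((s i).indicator (f i)) := fun i => (hf i).indicator (hs i)
  have hprod : ∀ x : ∀ i, Ω i, (Set.univ.pi s).indicator (fun x => ∏ i, f i (x i)) x =
      ∏ i, (s i).indicator (f i) (x i) := by
    intro x
    by_cases hx : x ∈ Set.univ.pi s
    · rw [Set.indicator_of_mem hx]
      exact Finset.prod_congr rfl fun i _ => (Set.indicator_of_mem (hx i trivial) _).symm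
    · rw [Set.indicator_of_notMem hx]
      obtain ⟨i, hi⟩ : ∃ i, x i ∉ s i := by simpa using hx
      exact (Finset.prod_eq_zero (Finset.mem_univ i) (Set.indicator_of_notMem hi _)).symm
  have hind : iIndepFun (fun i (x : ∀ i, Ω i) => (s i).indicator (f i) (x i))
      (Measure.pi ν) := iIndepFun_pi fun i => (hg i).aemeasurable
  rw [withDensity_apply _ (MeasurableSet.univ_pi hs),
    ← lintegral_indicator (MeasurableSet.univ_pi hs), lintegral_congr hprod,
    lintegral_prod_eq_prod_lintegral_of_indepFun _ _ hind
      fun i => (hg i).comp (measurable_pi_apply i)]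
  refine Finset.prod_congr rfl fun i _ => ?_
  rw [withDensity_apply _ (hs i), ← lintegral_indicator (hs i),
    (measurePreserving_eval ν i).lintegral_comp (hg i)]

/-- Lower bound for the sum of the two error probabilities of a test between measures with
densities `c * exp H` and `c * exp (-H)` with respect to a probability measure. -/
lemma exp_neg_le_add_compl {Ω : Type*} [MeasurableSpace Ω] (ρ : Measure Ω)
    [IsProbabilityMeasure ρ] {H : Ω → ℝ} (hH : Measurable H) (hH2 : MemLp H 2 ρ) {c : ℝ}
    (hc : 0 ≤ c) {T : Set Ω} (hT : MeasurableSet T)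
    [IsFiniteMeasure (ρ.withDensity fun x => ENNReal.ofReal (c * Real.exp (H x)))]
    [IsFiniteMeasure (ρ.withDensity fun x => ENNReal.ofReal (c * Real.exp (-H x)))] :
    c * Real.exp (-√(∫ x, H x ^ 2 ∂ρ)) ≤
      (ρ.withDensity fun x => ENNReal.ofReal (c * Real.exp (H x))).real T +
      (ρ.withDensity fun x => ENNReal.ofReal (c * Real.exp (-H x))).real Tᶜ := by
  have hint : Integrable (fun x => Real.exp (-|H x|)) ρ := by
    refine Integrable.of_bound (by fun_prop) 1 (ae_of_all _ fun x => ?_)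
    simp
  have habs : Integrable (fun x => |H x|) ρ := (hH2.integrable one_le_two).abs
  have hjensen : Real.exp (-∫ x, |H x| ∂ρ) ≤ ∫ x, Real.exp (-|H x|) ∂ρ := by
    have := convexOn_exp.map_integral_le (μ := ρ) (f := fun x => -|H x|)
      Real.continuous_exp.continuousOn isClosed_univ (by simp) habs.neg hint
    rwa [integral_neg] at this
  -- Cauchy–Schwarz, in the form that the variance of `|H|` is nonnegative.
  have hcs : ∫ x, |H x| ∂ρ ≤ √(∫ x, H x ^ 2 ∂ρ) := by
    refine Real.le_sqrt_of_sq_le ?_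
    have h2 : MemLp (fun x => |H x|) 2 ρ := hH2.abs
    have := variance_nonneg (fun x => |H x|) ρ
    rw [variance_eq_sub h2] at this
    simpa [Pi.pow_def, sq_abs] using this
  -- Both densities dominate `c * exp (-|H|)`, so its integral can be split between `T` and its
  -- complement.
  have hmain : ENNReal.ofReal (c * ∫ x, Real.exp (-|H x|) ∂ρ) ≤
      (ρ.withDensity fun x => ENNReal.ofReal (c * Real.exp (H x))) T +
      (ρ.withDensity fun x => ENNReal.ofReal (c * Real.exp (-H x))) Tᶜ := by
    rw [← integral_const_mul, ofReal_integral_eq_lintegral_ofReal (hint.const_mul c)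
      (ae_of_all _ fun x => by positivity), ← lintegral_add_compl _ hT,
      withDensity_apply _ hT, withDensity_apply _ hT.compl]
    refine add_le_add (lintegral_mono fun x => ENNReal.ofReal_le_ofReal ?_)
      (lintegral_mono fun x => ENNReal.ofReal_le_ofReal ?_)
    · gcongr
      exact neg_abs_le _
    · gcongr
      exact le_abs_self _
  have hle : c * Real.exp (-√(∫ x, H x ^ 2 ∂ρ)) ≤ c * ∫ x, Real.exp (-|H x|) ∂ρ := by
    refine mul_le_mul_of_nonneg_left (le_trans ?_ hjensen) hc
    gcongr
  refine hle.trans ?_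
  rw [← ENNReal.ofReal_le_ofReal_iff (by positivity), ENNReal.ofReal_add measureReal_nonneg
    measureReal_nonneg, ofReal_measureReal, ofReal_measureReal]
  exact hmain

/-- Lower bound for the sum of the two error probabilities of a test between product measures
whose factors are exponential tilts, in opposite directions, of common probability measures. -/
lemma prod_exp_neg_le_add_compl {ι : Type*} [Fintype ι] {P Q ν : ι → Measure ℝ}
    [∀ i, IsProbabilityMeasure (P i)] [∀ i, IsProbabilityMeasure (Q i)]
    [∀ i, IsProbabilityMeasure (ν i)] {b : ι → ℝ} (hb : ∀ i, 0 ≤ b i) {h : ι → ℝ → ℝ}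
    (hh : ∀ i, Measurable (h i)) (hh2 : ∀ i, MemLp (h i) 2 (ν i))
    (hP : ∀ i, P i = (ν i).withDensity fun x => ENNReal.ofReal (b i * Real.exp (h i x)))
    (hQ : ∀ i, Q i = (ν i).withDensity fun x => ENNReal.ofReal (b i * Real.exp (-h i x)))
    {T : Set (ι → ℝ)} (hT : MeasurableSet T) :
    (∏ i, b i) * Real.exp (-√(∑ i, Var[h i; ν i] + (∑ i, ∫ x, h i x ∂ν i) ^ 2)) ≤
      (Measure.pi P).real T + (Measure.pi Q).real Tᶜ := by
  set H : (ι → ℝ) → ℝ := fun x => ∑ i, h i (x i) with hHdef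
  have hHm : Measurable H := by fun_prop
  have hcoord : ∀ i, MemLp (fun x : ι → ℝ => h i (x i)) 2 (Measure.pi ν) := fun i =>
    (hh2 i).comp_measurePreserving (measurePreserving_eval ν i)
  have hH2 : MemLp H 2 (Measure.pi ν) := memLp_finsetSum _ fun i _ => hcoord i
  have hmean : ∫ x, H x ∂Measure.pi ν = ∑ i, ∫ x, h i x ∂ν i := by
    rw [integral_finsetSum _ fun i _ => (hcoord i).integrable one_le_two]
    refine Finset.sum_congr rfl fun i _ => ?_
    exact integral_comp_eval (hh i).aestronglyMeasurable
  have hvar : Var[H; Measure.pi ν] = ∑ i, Var[h i; ν i] := by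
    rw [← variance_sum_pi hh2]
    congr 1
    ext x
    simp [hHdef]
  -- Variance and mean are kept apart because the means may cancel across coordinates while the
  -- variances only add.
  have hsq : ∫ x, H x ^ 2 ∂Measure.pi ν = ∑ i, Var[h i; ν i] + (∑ i, ∫ x, h i x ∂ν i) ^ 2 := by
    have := variance_eq_sub hH2
    rw [hvar, hmean] at this
    simp only [Pi.pow_apply] at this
    linarith
  have key : ∀ (P : ι → Measure ℝ) [∀ i, IsProbabilityMeasure (P i)] (k : ι → ℝ → ℝ),
      (∀ i, Measurable (k i)) →
      (∀ i, P i = (ν i).withDensity fun x => ENNReal.ofReal (b i * Real.exp (k i x))) →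
      Measure.pi P = (Measure.pi ν).withDensity
        fun x => ENNReal.ofReal ((∏ i, b i) * Real.exp (∑ i, k i (x i))) := by
    intro P _ k hk hPk
    have : ∀ i, SigmaFinite
        ((ν i).withDensity fun x => ENNReal.ofReal (b i * Real.exp (k i x))) := fun i => by
      rw [← hPk i]; infer_instance
    rw [funext hPk, pi_withDensity _ _ fun i => by have := hk i; fun_prop]
    congr 1
    ext x
    rw [Real.exp_sum, ← Finset.prod_mul_distrib,
      ENNReal.ofReal_prod_of_nonneg fun i _ => mul_nonneg (hb i) (Real.exp_pos _).le]
  have h1 := key P h hh hP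
  have h2 := key Q (fun i x => -h i x) (fun i => (hh i).neg) hQ
  simp only [Finset.sum_neg_distrib] at h2
  have i1 : IsFiniteMeasure ((Measure.pi ν).withDensity
      fun x => ENNReal.ofReal ((∏ i, b i) * Real.exp (H x))) := by
    rw [← h1]; infer_instance
  have i2 : IsFiniteMeasure ((Measure.pi ν).withDensity
      fun x => ENNReal.ofReal ((∏ i, b i) * Real.exp (-H x))) := by
    rw [← h2]; infer_instance
  rw [h1, h2, ← hsq]
  exact exp_neg_le_add_compl _ hHm hH2 (Finset.prod_nonneg fun i _ => hb i) hT

/-! ### Measurability of labels and of the observation -/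

instance measurableSingletonClass_intUnits : MeasurableSingletonClass ℤˣ :=
  ⟨fun s => ⟨{(s : ℤ)}, measurableSet_singleton _, by ext t; simp [Units.ext_iff]⟩⟩

lemma measurableSet_label {n : ℕ} (U : Set (Label n)) : MeasurableSet U :=
  (Set.toFinite U).measurableSet

lemma measurable_symmMatrix {n : ℕ} : Measurable (symmMatrix (n := n)) := by
  refine measurable_pi_lambda _ fun i => measurable_pi_lambda _ fun j => ?_
  unfold symmMatrix
  split_ifs <;> fun_prop

instance isProbabilityMeasure_obsLaw {n : ℕ} (law : ℤˣ → Measure ℝ)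
    [∀ s, IsProbabilityMeasure (law s)] (σ : Label n) :
    IsProbabilityMeasure (obsLaw law σ) :=
  Measure.isProbabilityMeasure_map measurable_symmMatrix.aemeasurable

/-! ### Flipping one label -/

/-- The label vector obtained by changing the sign of the `i`-th label. -/
def flip {n : ℕ} (σ : Label n) (i : Fin n) : Label n := Function.update σ i (-σ i)

lemma flip_self {n : ℕ} (σ : Label n) (i : Fin n) : flip σ i i = -σ i := by simp [flip]

lemma flip_of_ne {n : ℕ} (σ : Label n) {i j : Fin n} (h : j ≠ i) : flip σ i j = σ j := by
  simp [flip, h]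

lemma flip_flip {n : ℕ} (σ : Label n) (i : Fin n) : flip (flip σ i) i = σ := by
  ext j
  by_cases h : j = i
  · subst h; simp [flip_self]
  · simp [flip_of_ne _ h]

/-- The off-diagonal entries in the row or column `i`. -/
def incident {n : ℕ} (i : Fin n) : Finset (UpperIdx n) :=
  Finset.univ.filter fun e => ¬(e.1.1 = i ↔ e.1.2 = i)

lemma flip_mul_flip_of_mem {n : ℕ} (σ : Label n) {i : Fin n} {e : UpperIdx n}
    (h : e ∈ incident i) :
    flip σ i e.1.1 * flip σ i e.1.2 = -(σ e.1.1 * σ e.1.2) := by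
  have h' : ¬(e.1.1 = i ↔ e.1.2 = i) := by simpa [incident] using h
  by_cases h1 : e.1.1 = i <;> by_cases h2 : e.1.2 = i
  · exact absurd (iff_of_true h1 h2) h'
  · rw [flip_of_ne _ h2, h1, flip_self, neg_mul]
  · rw [flip_of_ne _ h1, h2, flip_self, mul_neg]
  · exact absurd (iff_of_false h1 h2) h'

lemma flip_mul_flip_of_notMem {n : ℕ} (σ : Label n) {i : Fin n} {e : UpperIdx n}
    (h : e ∉ incident i) :
    flip σ i e.1.1 * flip σ i e.1.2 = σ e.1.1 * σ e.1.2 := by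
  have h' : e.1.1 = i ↔ e.1.2 = i := by simpa [incident] using h
  by_cases h1 : e.1.1 = i
  · rw [h1, h'.1 h1, flip_self, neg_mul_neg]
  · rw [flip_of_ne _ h1, flip_of_ne _ (mt h'.2 h1)]

/-- The position on or above the diagonal of the entry `(i, j)` of a symmetric matrix. -/
def edge {n : ℕ} (i j : Fin n) : UpperIdx n :=
  if h : i ≤ j then ⟨(i, j), h⟩ else ⟨(j, i), le_of_not_ge h⟩

lemma mul_edge {n : ℕ} (σ : Label n) (i j : Fin n) :
    σ (edge i j).1.1 * σ (edge i j).1.2 = σ i * σ j := by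
  unfold edge
  split_ifs
  · rfl
  · exact mul_comm _ _

/-- Off-diagonal positions in row or column `i` correspond bijectively to the other nodes `j`. This
turns the mean of the log-likelihood into a sum of labels. -/
lemma sum_incident {M : Type*} [AddCommMonoid M] {n : ℕ} (i : Fin n) (F : UpperIdx n → M) :
    ∑ e ∈ incident i, F e = ∑ j ∈ Finset.univ.erase i, F (edge i j) := by
  symm
  refine Finset.sum_bij (fun j _ => edge i j) ?_ ?_ ?_ fun _ _ => rfl
  · intro j hj
    have hj : j ≠ i := Finset.ne_of_mem_erase hj
    unfold edge incident
    split_ifs <;> simp [hj]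
  · intro j hj k hk hjk
    have hj : j ≠ i := Finset.ne_of_mem_erase hj
    have hk : k ≠ i := Finset.ne_of_mem_erase hk
    unfold edge at hjk
    split_ifs at hjk <;> simp_all
  · intro e he
    have he' : ¬(e.1.1 = i ↔ e.1.2 = i) := by simpa [incident] using he
    obtain ⟨⟨a, b⟩, hab⟩ := e
    simp only at he' hab
    by_cases ha : a = i
    · have hb : b ≠ i := fun hb => he' (iff_of_true ha hb)
      subst ha
      exact ⟨b, by simp [hb], by simp [edge, hab]⟩
    · have hb : b = i := by by_contra hb; exact he' (iff_of_false ha hb)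
      subst hb
      exact ⟨a, by simp [ha], by simp [edge, not_le.2 (lt_of_le_of_ne hab ha)]⟩

lemma card_incident {n : ℕ} (i : Fin n) : (incident i).card = n - 1 := by
  rw [Finset.card_eq_sum_ones, sum_incident]
  simp

/-! ### Testing the label of one node -/

/-- The two entry laws are the tilts by `exp h` and `exp (-h)`, up to the constant `B`, of a
probability measure under which `h` has second moment at most `V`; thus `B` is the Bhattacharyya
coefficient of the two laws. -/
def IsExpTilt (law : ℤˣ → Measure ℝ) (B V : ℝ) : Prop :=
  ∃ r : Measure ℝ, IsProbabilityMeasure r ∧ ∃ h : ℝ → ℝ, Measurable h ∧ MemLp h 2 r ∧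
    ∫ x, h x ^ 2 ∂r ≤ V ∧ ∀ s : ℤˣ, law s =
      r.withDensity fun x => ENNReal.ofReal (B * Real.exp (((s : ℤ) : ℝ) * h x))

lemma sq_intUnit (s : ℤˣ) : (((s : ℤ) : ℝ)) ^ 2 = 1 := by
  rcases Int.units_eq_one_or s with rfl | rfl <;> simp

/-- Lower bound for the sum of the two error probabilities of a test for the label of the
node `i`, the other labels being known and balanced. -/
lemma le_obsLaw_add_obsLaw_flip {n : ℕ} {law : ℤˣ → Measure ℝ}
    [∀ s, IsProbabilityMeasure (law s)] {B V : ℝ} (hB : 0 ≤ B) (htilt : IsExpTilt law B V)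
    (σ : Label n) (i : Fin n) (hbal : |∑ j ∈ Finset.univ.erase i, (σ j : ℤ)| ≤ 1)
    {T : Set (Fin n → Fin n → ℝ)} (hT : MeasurableSet T) :
    B ^ (n - 1) * Real.exp (-√(n * V)) ≤
      (obsLaw law σ).real T + (obsLaw law (flip σ i)).real Tᶜ := by
  obtain ⟨r, hr, h, hh, hh2, hV, hlaw⟩ := htilt
  classical
  set c : UpperIdx n → ℝ := fun e => ((σ e.1.1 * σ e.1.2 : ℤˣ) : ℤ) with hc
  -- Entries not touched by the flip have the same law under both hypotheses, so they serve as their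
  -- own reference measure, with constant 1 and exponent 0.
  set ν : UpperIdx n → Measure ℝ := fun e =>
    if e ∈ incident i then r else law (σ e.1.1 * σ e.1.2) with hν
  set b : UpperIdx n → ℝ := fun e => if e ∈ incident i then B else 1 with hb
  set k : UpperIdx n → ℝ → ℝ := fun e x => if e ∈ incident i then c e * h x else 0 with hk
  have hνp : ∀ e, IsProbabilityMeasure (ν e) := fun e => by
    simp only [hν]; split_ifs <;> infer_instance
  have hb0 : ∀ e, 0 ≤ b e := fun e => by simp only [hb]; split_ifs <;> simp [hB]
  have hkm : ∀ e, Measurable (k e) := fun e => by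
    simp only [hk]; split_ifs <;> fun_prop
  have hk2 : ∀ e, MemLp (k e) 2 (ν e) := fun e => by
    simp only [hk, hν]
    split_ifs
    · exact hh2.const_mul _
    · exact MemLp.zero'
  have hP : ∀ e : UpperIdx n, law (σ e.1.1 * σ e.1.2) =
      (ν e).withDensity fun x => ENNReal.ofReal (b e * Real.exp (k e x)) := fun e => by
    by_cases he : e ∈ incident i
    · simp only [hν, hb, hk, he, if_true]
      exact hlaw _
    · simp [hν, hb, hk, he]
  have hQ : ∀ e : UpperIdx n, law (flip σ i e.1.1 * flip σ i e.1.2) =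
      (ν e).withDensity fun x => ENNReal.ofReal (b e * Real.exp (-k e x)) := fun e => by
    by_cases he : e ∈ incident i
    · simp only [hν, hb, hk, he, if_true, flip_mul_flip_of_mem σ he, hc]
      rw [hlaw]
      simp
    · simp [hν, hb, hk, he, flip_mul_flip_of_notMem σ he]
  have key := prod_exp_neg_le_add_compl hb0 hkm hk2 hP hQ (measurable_symmMatrix hT)
  have hprod : ∏ e, b e = B ^ (n - 1) := by
    simp only [hb]
    rw [Finset.prod_ite_mem, Finset.univ_inter, Finset.prod_const, card_incident]
  have hvar : ∑ e, Var[k e; ν e] = (n - 1 : ℕ) * Var[h; r] := by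
    have : ∀ e, Var[k e; ν e] = if e ∈ incident i then Var[h; r] else 0 := fun e => by
      by_cases he : e ∈ incident i
      · simp only [hk, hν, he, if_true]
        rw [variance_const_mul, hc, sq_intUnit, one_mul]
      · simp only [hk, hν, he, if_false]
        exact variance_zero _
    rw [Finset.sum_congr rfl fun e _ => this e, Finset.sum_ite_mem, Finset.univ_inter,
      Finset.sum_const, card_incident, nsmul_eq_mul]
  have hmean : ∑ e, ∫ x, k e x ∂ν e =
      ((σ i : ℤ) : ℝ) * ((∑ j ∈ Finset.univ.erase i, (σ j : ℤ) : ℤ) : ℝ) * ∫ x, h x ∂r := by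
    have : ∀ e, ∫ x, k e x ∂ν e = if e ∈ incident i then c e * ∫ x, h x ∂r else 0 := fun e => by
      by_cases he : e ∈ incident i
      · simp only [hk, hν, he, if_true]
        exact integral_const_mul _ _
      · simp [hk, he]
    rw [Finset.sum_congr rfl fun e _ => this e, Finset.sum_ite_mem, Finset.univ_inter,
      sum_incident, ← Finset.sum_mul]
    congr 1
    push_cast
    rw [Finset.mul_sum]
    refine Finset.sum_congr rfl fun j _ => ?_
    simp only [hc, mul_edge]
    push_cast
    rfl
  rw [hprod, hvar, hmean, mul_pow, mul_pow, sq_intUnit, one_mul] at key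
  have hmap : ∀ (τ : Label n) {U : Set (Fin n → Fin n → ℝ)}, MeasurableSet U →
      (obsLaw law τ).real U = (Measure.pi fun e : UpperIdx n => law (τ e.1.1 * τ e.1.2)).real
        (symmMatrix ⁻¹' U) := fun τ U hU => map_measureReal_apply measurable_symmMatrix hU
  rw [hmap _ hT, hmap _ hT.compl]
  refine le_trans ?_ key
  have hn : 1 ≤ n := i.pos
  -- Balance enters here: without it the squared mean of `H` could be of order `n²` times `(∫ h)²`.
  have hS : ((∑ j ∈ Finset.univ.erase i, (σ j : ℤ) : ℤ) : ℝ) ^ 2 ≤ 1 := by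
    rw [sq_le_one_iff_abs_le_one]
    exact_mod_cast hbal
  have hv := variance_eq_sub hh2
  simp only [Pi.pow_apply] at hv
  have hv0 := variance_nonneg h r
  have hn' : (1 : ℝ) ≤ n := by exact_mod_cast hn
  gcongr
  rw [Nat.cast_sub hn]
  push_cast
  have h1 : ((∑ j ∈ Finset.univ.erase i, (σ j : ℤ) : ℤ) : ℝ) ^ 2 * (∫ x, h x ∂r) ^ 2 ≤
      n * (∫ x, h x ∂r) ^ 2 :=
    mul_le_mul_of_nonneg_right (hS.trans hn') (sq_nonneg _)
  have h2 : (n : ℝ) * (∫ x, h x ^ 2 ∂r) ≤ n * V := by gcongr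
  push_cast at h1
  nlinarith

/-! ### Reduction of the estimation problem to the testing problems -/

/-- The sign for which `τ` agrees with `σ₀` on at least half of the nodes outside `S`. -/
def majoritySign {n : ℕ} (σ₀ : Label n) (S : Finset (Fin n)) (τ : Label n) : ℤˣ :=
  if Sᶜ.card ≤ 2 * (Sᶜ.filter fun i => τ i = σ₀ i).card then 1 else -1

/-- Labels are binary, so wherever `τ` disagrees with `σ₀`, `-τ` agrees. -/
lemma card_le_two_mul_card_majoritySign {n : ℕ} (σ₀ : Label n) (S : Finset (Fin n))
    (τ : Label n) :
    Sᶜ.card ≤ 2 * (Sᶜ.filter fun i => majoritySign σ₀ S τ * τ i = σ₀ i).card := by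
  unfold majoritySign
  split_ifs with h
  · simpa using h
  · have h1 := Finset.card_filter_add_card_filter_not (s := Sᶜ) (fun i => τ i = σ₀ i)
    have h2 : (Sᶜ.filter fun i => ¬ τ i = σ₀ i) ⊆ Sᶜ.filter fun i => -1 * τ i = σ₀ i := by
      refine Finset.monotone_filter_right _ fun i _ hi => ?_
      rcases Int.units_eq_one_or (τ i) with h | h <;>
        rcases Int.units_eq_one_or (σ₀ i) with h' | h' <;> simp_all
    have := Finset.card_le_card h2
    omega

/-- If the labels outside a small set `S` are known, then the error of an estimate is bounded
below by the error on `S`, without minimization over the global sign. -/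
lemma card_ne_le_err {n : ℕ} {σ₀ σ : Label n} {S : Finset (Fin n)} (hS : 3 * S.card ≤ n)
    (hσ : ∀ i ∉ S, σ i = σ₀ i) (τ : Label n) :
    1 / (n : ℝ) * (S.filter fun i => majoritySign σ₀ S τ * τ i ≠ σ i).card ≤ err τ σ := by
  unfold err
  refine Finset.le_inf' _ _ fun g _ => ?_
  rw [Finset.sum_boole]
  refine mul_le_mul_of_nonneg_left (Nat.cast_le.2 ?_) (by positivity)
  have h1 := card_le_two_mul_card_majoritySign σ₀ S τ
  generalize majoritySign σ₀ S τ = g₀ at h1 ⊢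
  by_cases hg : g = g₀
  · rw [hg]
    exact Finset.card_le_card (Finset.filter_subset_filter _ (Finset.subset_univ _))
  · have hg' : g = -g₀ := by
      rcases Int.units_eq_one_or g with h | h <;>
        rcases Int.units_eq_one_or g₀ with h' | h' <;> simp_all
    have h2 : (Sᶜ.filter fun i => g₀ * τ i = σ₀ i) ⊆
        Finset.univ.filter fun i => g * τ i ≠ σ i := by
      intro i hi
      simp only [Finset.mem_filter, Finset.mem_compl, Finset.mem_univ, true_and] at hi ⊢
      rw [hσ i hi.1, hg', ← hi.2, neg_mul]
      rcases Int.units_eq_one_or (g₀ * τ i) with h | h <;> rw [h] <;> decide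
    have h3 := Finset.card_le_card h2
    have h4 : S.card + Sᶜ.card = n := by simp
    have h5 := Finset.card_filter_le S fun i => g₀ * τ i ≠ σ i
    omega

/-- A lower bound for the minimax risk in terms of lower bounds for tests between label vectors
which differ in one node. -/
lemma le_minimaxRisk {n : ℕ} {law : ℤˣ → Measure ℝ} [∀ s, IsProbabilityMeasure (law s)]
    {Θ : Set (Label n)} {F : Finset (Label n)} (hF : F.Nonempty) (hFΘ : ∀ σ ∈ F, σ ∈ Θ)
    {S : Finset (Fin n)} (hS : 3 * S.card ≤ n) {σ₀ : Label n}
    (hσ₀ : ∀ σ ∈ F, ∀ i ∉ S, σ i = σ₀ i) {m : ℕ}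
    (hm : ∀ σ ∈ F, m ≤ (S.filter fun i => flip σ i ∈ F).card) {t : ℝ} (ht : 0 ≤ t)
    (htest : ∀ σ ∈ F, ∀ i ∈ S, flip σ i ∈ F → ∀ T, MeasurableSet T →
      t ≤ (obsLaw law σ).real T + (obsLaw law (flip σ i)).real Tᶜ) :
    m / (2 * n : ℝ) * t ≤ minimaxRisk law Θ := by
  have : Nonempty (Estimator n) := ⟨⟨fun _ _ => 1, measurable_const⟩⟩
  refine le_ciInf fun f => ?_
  -- The sign is chosen by comparison with the fixed `σ₀`, so `E σ i` depends on `σ` only through `σ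
  -- i`; this makes it a test between `σ` and `flip σ i`.
  set E : Label n → Fin n → Set (Fin n → Fin n → ℝ) := fun σ i =>
    {A | majoritySign σ₀ S (f.1 A) * f.1 A i ≠ σ i} with hE
  have hEm : ∀ σ i, MeasurableSet (E σ i) := fun σ i =>
    f.2 (measurableSet_label {τ | majoritySign σ₀ S τ * τ i ≠ σ i})
  have hEflip : ∀ σ i, E (flip σ i) i = (E σ i)ᶜ := fun σ i => by
    ext A
    simp only [hE, Set.mem_ofPred_eq, Set.mem_compl_iff, flip_self]
    generalize majoritySign σ₀ S (f.1 A) * f.1 A i = u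
    rcases Int.units_eq_one_or u with h | h <;>
      rcases Int.units_eq_one_or (σ i) with h' | h' <;> simp_all
  have hrisk : ∀ σ ∈ F, 1 / (n : ℝ) * ∑ i ∈ S, (obsLaw law σ).real (E σ i) ≤
      risk law f σ := by
    intro σ hσ
    have hi : ∀ i ∈ S, Integrable ((E σ i).indicator fun _ => (1 : ℝ)) (obsLaw law σ) :=
      fun i _ => (integrable_const _).indicator (hEm σ i)
    have h1 : ∑ i ∈ S, (obsLaw law σ).real (E σ i) =
        ∫ A, ∑ i ∈ S, (E σ i).indicator (fun _ => (1 : ℝ)) A ∂obsLaw law σ := by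
      rw [integral_finsetSum _ hi]
      refine Finset.sum_congr rfl fun i _ => ?_
      rw [integral_indicator_const _ (hEm σ i)]
      simp
    rw [h1, ← integral_const_mul]
    refine integral_mono ((integrable_finsetSum _ hi).const_mul _) ?_ fun A => ?_
    · have hmeas : Measurable fun A => err (f.1 A) σ :=
        (measurable_of_finite fun τ => err τ σ).comp f.2
      obtain ⟨M, hM⟩ := (Set.finite_range fun τ : Label n => ‖err τ σ‖).bddAbove
      exact Integrable.of_bound hmeas.aestronglyMeasurable M
        (ae_of_all _ fun A => hM ⟨f.1 A, rfl⟩)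
    · refine le_trans (le_of_eq ?_) (card_ne_le_err hS (hσ₀ σ hσ) (f.1 A))
      simp only [Set.indicator_apply, hE, Set.mem_ofPred_eq, Finset.sum_boole]
  set D := (F ×ˢ S).filter fun x => flip x.1 x.2 ∈ F with hD
  have hDcard : (F.card * m : ℝ) ≤ D.card := by
    have : D.card = ∑ σ ∈ F, (S.filter fun i => flip σ i ∈ F).card := by
      simp only [hD, Finset.card_filter, Finset.sum_product]
    rw [this]
    have := Finset.card_nsmul_le_sum F _ m hm
    exact_mod_cast (by simpa using this)
  -- Flipping is an involution of `D`, so the second-kind errors sum to the same total as the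
  -- first-kind errors.
  have hswap : ∑ x ∈ D, (obsLaw law (flip x.1 x.2)).real (E x.1 x.2)ᶜ =
      ∑ x ∈ D, (obsLaw law x.1).real (E x.1 x.2) := by
    refine Finset.sum_bij' (fun x _ => (flip x.1 x.2, x.2)) (fun x _ => (flip x.1 x.2, x.2))
      ?_ ?_ ?_ ?_ ?_
    · intro x hx
      simp only [hD, Finset.mem_filter, Finset.mem_product, flip_flip] at hx ⊢
      tauto
    · intro x hx
      simp only [hD, Finset.mem_filter, Finset.mem_product, flip_flip] at hx ⊢
      tauto
    · intro x _; simp [flip_flip]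
    · intro x _; simp [flip_flip]
    · intro x _; simp [hEflip]
  have hsum : (D.card : ℝ) * t ≤ 2 * ∑ x ∈ D, (obsLaw law x.1).real (E x.1 x.2) := by
    rw [two_mul]
    nth_rewrite 2 [← hswap]
    rw [← Finset.sum_add_distrib, ← nsmul_eq_mul]
    refine Finset.card_nsmul_le_sum _ _ _ fun x hx => ?_
    simp only [hD, Finset.mem_filter, Finset.mem_product] at hx
    exact htest _ hx.1.1 _ hx.1.2 hx.2 _ (hEm _ _)
  have hsub : ∑ x ∈ D, (obsLaw law x.1).real (E x.1 x.2) ≤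
      ∑ σ ∈ F, ∑ i ∈ S, (obsLaw law σ).real (E σ i) := by
    rw [← Finset.sum_product']
    exact Finset.sum_le_sum_of_subset_of_nonneg (Finset.filter_subset _ _)
      fun _ _ _ => measureReal_nonneg
  have htotal : ∑ σ ∈ F, m / (2 * n : ℝ) * t ≤ ∑ σ ∈ F, risk law f σ := by
    refine le_trans ?_ (Finset.sum_le_sum hrisk)
    rw [Finset.sum_const, nsmul_eq_mul, ← Finset.mul_sum]
    have h1 : F.card * m * t ≤ D.card * t := mul_le_mul_of_nonneg_right hDcard ht
    calc (F.card : ℝ) * (m / (2 * n) * t) = 1 / n * (F.card * m * t / 2) := by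
          ring
      _ ≤ _ := by gcongr; linarith
  obtain ⟨σ, hσ, hle⟩ := Finset.exists_le_of_sum_le hF htotal
  exact le_ciSup_of_le (Set.finite_range _).bddAbove ⟨σ, hFΘ σ hσ⟩ hle

/-! ### A family of nearly balanced label vectors -/

lemma sum_erase_flip {n : ℕ} (σ : Label n) (i : Fin n) :
    ∑ j ∈ Finset.univ.erase i, (flip σ i j : ℤ) = ∑ j ∈ Finset.univ.erase i, (σ j : ℤ) :=
  Finset.sum_congr rfl fun _ hj => by rw [flip_of_ne _ (Finset.ne_of_mem_erase hj)]

lemma sum_eq_sum_erase_add {n : ℕ} (σ : Label n) (i : Fin n) :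
    ∑ j, (σ j : ℤ) = ∑ j ∈ Finset.univ.erase i, (σ j : ℤ) + σ i :=
  (Finset.sum_erase_add _ _ (Finset.mem_univ i)).symm

lemma sum_flip {n : ℕ} (σ : Label n) (i : Fin n) :
    ∑ j, (flip σ i j : ℤ) = ∑ j, (σ j : ℤ) - 2 * σ i := by
  rw [sum_eq_sum_erase_add, sum_erase_flip, sum_eq_sum_erase_add σ i, flip_self, Units.val_neg]
  ring

/-- The label vector `(1, -1, 1, -1, …)`. -/
def alternating (n : ℕ) : Label n := fun i => (-1) ^ (i : ℕ)

lemma sum_alternating (n : ℕ) :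
    ∑ i, (alternating n i : ℤ) = if Even n then 0 else 1 := by
  rw [← neg_one_geom_sum, ← Fin.sum_univ_eq_sum_range]
  simp [alternating]

lemma sum_filter_lt {n k : ℕ} (hk : k ≤ n) (f : ℕ → ℤ) :
    ∑ i ∈ Finset.univ.filter (fun i : Fin n => (i : ℕ) < k), f i = ∑ i ∈ Finset.range k, f i := by
  rw [Finset.sum_filter, Fin.sum_univ_eq_sum_range (fun i => if i < k then f i else 0),
    ← Finset.sum_filter]
  congr 1
  ext i
  simp only [Finset.mem_filter, Finset.mem_range]
  omega

lemma sum_add_two_mul_card_neg {n : ℕ} (S : Finset (Fin n)) (σ : Label n) :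
    ∑ i ∈ S, (σ i : ℤ) + 2 * (S.filter fun i => σ i = -1).card = S.card := by
  rw [Finset.card_filter, Finset.card_eq_sum_ones]
  push_cast
  rw [Finset.mul_sum, ← Finset.sum_add_distrib]
  refine Finset.sum_congr rfl fun i _ => ?_
  rcases Int.units_eq_one_or (σ i) with h | h <;> rw [h] <;> decide

lemma sum_eq_two_mul_card_one_sub {n : ℕ} (S : Finset (Fin n)) (σ : Label n) :
    ∑ i ∈ S, (σ i : ℤ) = 2 * (S.filter fun i => σ i = 1).card - S.card := by
  rw [Finset.card_filter, Finset.card_eq_sum_ones]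
  push_cast
  rw [Finset.mul_sum, ← Finset.sum_sub_distrib]
  refine Finset.sum_congr rfl fun i _ => ?_
  rcases Int.units_eq_one_or (σ i) with h | h <;> rw [h] <;> decide

/-- Non-asymptotic lower bound for the minimax risk over a parameter space which contains all
nearly balanced label vectors. -/
lemma le_minimaxRisk_of_isExpTilt {n m : ℕ} (hm : 6 * m ≤ n) {law : ℤˣ → Measure ℝ}
    [∀ s, IsProbabilityMeasure (law s)] {B V : ℝ} (hB : 0 ≤ B) (htilt : IsExpTilt law B V)
    {Θ : Set (Label n)}
    (hΘ : ∀ σ : Label n, -1 ≤ ∑ i, (σ i : ℤ) → ∑ i, (σ i : ℤ) ≤ 2 → σ ∈ Θ) :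
    m / (2 * n : ℝ) * (B ^ (n - 1) * Real.exp (-√(n * V))) ≤ minimaxRisk law Θ := by
  classical
  -- The even size makes the alternating vector sum to 0 on `S`, and `6 * m ≤ n` gives `3 * S.card ≤
  -- n`.
  set S : Finset (Fin n) := Finset.univ.filter fun i => (i : ℕ) < 2 * m with hSdef
  -- Flips change the label sum by 2. In the window from -1 to 2, flipping a `-1` is allowed when
  -- the sum is at most 0, and flipping a `1` when it is positive.
  set F : Finset (Label n) := Finset.univ.filter fun σ =>
    (∀ i ∉ S, σ i = alternating n i) ∧ -1 ≤ ∑ i, (σ i : ℤ) ∧ ∑ i, (σ i : ℤ) ≤ 2 with hFdef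
  have hmem : ∀ σ, σ ∈ F ↔ (∀ i ∉ S, σ i = alternating n i) ∧
      -1 ≤ ∑ i, (σ i : ℤ) ∧ ∑ i, (σ i : ℤ) ≤ 2 := by simp [hFdef]
  have hScard : S.card = 2 * m := by
    have := sum_filter_lt (n := n) (k := 2 * m) (by omega) fun _ => 1
    simp only [Finset.sum_const, nsmul_eq_mul, mul_one, Finset.card_range] at this
    exact_mod_cast this
  have hS0 : ∑ i ∈ S, (alternating n i : ℤ) = 0 := by
    have := sum_filter_lt (n := n) (k := 2 * m) (by omega) fun i => (-1) ^ i
    rw [neg_one_geom_sum, if_pos (even_two_mul m)] at this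
    rw [← this]
    simp [hSdef, alternating]
  have h0 := sum_alternating n
  have hflip : ∀ σ ∈ F, ∀ i ∈ S, -1 ≤ ∑ j, (σ j : ℤ) - 2 * σ i →
      ∑ j, (σ j : ℤ) - 2 * σ i ≤ 2 → flip σ i ∈ F := by
    intro σ hσ i hi h1 h2
    rw [hmem, sum_flip]
    refine ⟨fun j hj => ?_, h1, h2⟩
    rw [flip_of_ne _ (ne_of_mem_of_not_mem hi hj).symm]
    exact ((hmem σ).1 hσ).1 j hj
  refine le_minimaxRisk (F := F) (S := S) (σ₀ := alternating n) ⟨alternating n, ?_⟩ ?_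
    (by omega) ?_ ?_ (by positivity) ?_
  · rw [hmem]
    refine ⟨fun _ _ => rfl, ?_⟩
    split_ifs at h0 <;> omega
  · exact fun σ hσ => hΘ σ ((hmem σ).1 hσ).2.1 ((hmem σ).1 hσ).2.2
  · exact fun σ hσ => ((hmem σ).1 hσ).1
  · intro σ hσ
    obtain ⟨hagree, hl, hu⟩ := (hmem σ).1 hσ
    have hc : ∑ i ∈ Sᶜ, (σ i : ℤ) = ∑ i ∈ Sᶜ, (alternating n i : ℤ) :=
      Finset.sum_congr rfl fun i hi => by rw [hagree i (Finset.mem_compl.1 hi)]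
    have e1 := Finset.sum_add_sum_compl S fun i => (σ i : ℤ)
    have e2 := Finset.sum_add_sum_compl S fun i => (alternating n i : ℤ)
    -- The labels outside `S` sum to 0 or 1, so in either case at least half of the `2 * m` labels
    -- in `S` have the sign that may be flipped.
    rcases le_or_gt (∑ i, (σ i : ℤ)) 0 with hle | hgt
    · have h1 := sum_add_two_mul_card_neg S σ
      have h2 : (S.filter fun i => σ i = -1) ⊆ S.filter fun i => flip σ i ∈ F := by
        refine Finset.monotone_filter_right S fun i hi h => ?_
        refine hflip σ hσ i hi ?_ ?_ <;> rw [h] <;> push_cast <;> omega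
      have h3 := Finset.card_le_card h2
      split_ifs at h0 <;> omega
    · have h1 := sum_eq_two_mul_card_one_sub S σ
      have h2 : (S.filter fun i => σ i = 1) ⊆ S.filter fun i => flip σ i ∈ F := by
        refine Finset.monotone_filter_right S fun i hi h => ?_
        refine hflip σ hσ i hi ?_ ?_ <;> rw [h] <;> push_cast <;> omega
      have h3 := Finset.card_le_card h2
      split_ifs at h0 <;> omega
  · intro σ hσ i _ hi T hT
    refine le_obsLaw_add_obsLaw_flip hB htilt σ i ?_ hT
    -- The sum without node `i` is the midpoint of the label sums before and after the flip, hence 0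
    -- or 1.
    have h1 := ((hmem σ).1 hσ).2
    have h2 := ((hmem _).1 hi).2
    rw [sum_flip] at h2
    rw [sum_eq_sum_erase_add σ i] at h1 h2
    rcases Int.units_eq_one_or (σ i) with h | h <;> rw [h] at h1 h2 <;> push_cast at h1 h2 <;>
      rw [abs_le] <;> omega

/-! ### Asymptotics -/

/-- Conversion of the non-asymptotic lower bound into an asymptotic one. Here `Λ n` is the
exponent, and the Bhattacharyya coefficient of the entry laws is at least
`exp (-(1 + δ n) * Λ n / n)`. -/
lemma exists_tendsto_zero_le_minimaxRisk {law : ℕ → ℤˣ → Measure ℝ}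
    (hlaw : ∀ n s, IsProbabilityMeasure (law n s)) {Θ : ∀ n, Set (Label n)}
    (hΘ : ∀ᶠ n : ℕ in atTop, ∀ σ : Label n, -1 ≤ ∑ i, (σ i : ℤ) → ∑ i, (σ i : ℤ) ≤ 2 → σ ∈ Θ n)
    {B V Λ δ : ℕ → ℝ} {K : ℝ} (hΛ : Tendsto Λ atTop atTop) (hδ : Tendsto δ atTop (𝓝 0))
    (htilt : ∀ᶠ n in atTop, IsExpTilt (law n) (B n) (V n))
    (hB : ∀ᶠ n in atTop, 0 < B n ∧ B n ≤ 1 ∧ -(n * Real.log (B n)) ≤ (1 + δ n) * Λ n)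
    (hV : ∀ᶠ n in atTop, n * V n ≤ K * Λ n) :
    ∃ ξ : ℕ → ℝ, Tendsto ξ atTop (𝓝 0) ∧ ∀ᶠ n : ℕ in atTop,
      Real.exp (-((1 + ξ n) * Λ n)) ≤ minimaxRisk (law n) (Θ n) := by
  have hinv : Tendsto (fun n => (√(Λ n))⁻¹) atTop (𝓝 0) :=
    tendsto_inv_atTop_zero.comp (Real.tendsto_sqrt_atTop.comp hΛ)
  -- The three terms pay for the Bhattacharyya coefficient, the fluctuation `√(n V) ≤ √(K Λ)`, and
  -- the averaging constant 1/24 obtained with `m = n / 6`.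
  refine ⟨fun n => δ n + √K * (√(Λ n))⁻¹ + Real.log 24 * (Λ n)⁻¹, ?_, ?_⟩
  · simpa using (hδ.add (hinv.const_mul √K)).add
      ((tendsto_inv_atTop_zero.comp hΛ).const_mul (Real.log 24))
  · filter_upwards [hΘ, htilt, hB, hV, hΛ.eventually_gt_atTop 0, eventually_ge_atTop 12] with
      n hΘn htn ⟨hB0, hB1, hBn⟩ hVn hΛn hn
    have := hlaw n
    have key := le_minimaxRisk_of_isExpTilt (n := n) (m := n / 6) (by omega) hB0.le htn hΘn
    refine le_trans ?_ key
    have hn0 : (0 : ℝ) < n := by positivity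
    have h1 : (1 / 24 : ℝ) ≤ (n / 6 : ℕ) / (2 * n : ℝ) := by
      rw [le_div_iff₀ (by positivity)]
      have : n ≤ 12 * (n / 6) := by omega
      have : (n : ℝ) ≤ 12 * ((n / 6 : ℕ) : ℝ) := by exact_mod_cast this
      linarith
    have h2 : Real.exp (n * Real.log (B n)) ≤ B n ^ (n - 1) := by
      rw [Real.exp_nat_mul, Real.exp_log hB0]
      exact pow_le_pow_of_le_one hB0.le hB1 (Nat.sub_le _ _)
    have h3 : √(n * V n) ≤ √K * √(Λ n) := by
      rw [← Real.sqrt_mul' _ hΛn.le]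
      exact Real.sqrt_le_sqrt hVn
    have h4 : √(Λ n) = (√(Λ n))⁻¹ * Λ n := by
      have : √(Λ n) ≠ 0 := (Real.sqrt_pos.2 hΛn).ne'
      field_simp
      exact Real.sq_sqrt hΛn.le
    have h5 : (Λ n)⁻¹ * Λ n = 1 := inv_mul_cancel₀ hΛn.ne'
    calc Real.exp (-((1 + (δ n + √K * (√(Λ n))⁻¹ + Real.log 24 * (Λ n)⁻¹)) * Λ n))
        = Real.exp (-Real.log 24 + (-((1 + δ n) * Λ n) + -(√K * √(Λ n)))) := by
          congr 1
          linear_combination √K * h4 - Real.log 24 * h5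
      _ ≤ Real.exp (-Real.log 24 + (n * Real.log (B n) + -√(n * V n))) := by
          gcongr
          linarith
      _ = 1 / 24 * (Real.exp (n * Real.log (B n)) * Real.exp (-√(n * V n))) := by
          rw [Real.exp_add, Real.exp_add, Real.exp_neg, Real.exp_log (by norm_num), one_div]
      _ ≤ _ := by gcongr

/-! ### The entry laws as exponential tilts -/

/-- At an atom with masses `a` and `b` under the two laws, the geometric mean is the reference mass
and half the log-ratio is the tilt. -/
lemma sqrt_mul_mul_exp_half_log {a b : ℝ} (ha : 0 < a) (hb : 0 < b) :
    √(a * b) * Real.exp (1 / 2 * Real.log (a / b)) = a := by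
  have : Real.exp (1 / 2 * Real.log (a / b)) = √(a / b) := by
    rw [one_div_mul_eq_div, Real.exp_half, Real.exp_log (by positivity)]
  rw [this, ← Real.sqrt_mul (by positivity), show a * b * (a / b) = a ^ 2 by field_simp,
    Real.sqrt_sq ha.le]

lemma sqrt_mul_mul_exp_neg_half_log {a b : ℝ} (ha : 0 < a) (hb : 0 < b) :
    √(a * b) * Real.exp (-(1 / 2 * Real.log (a / b))) = b := by
  rw [← mul_neg, ← Real.log_inv, inv_div, mul_comm a b, sqrt_mul_mul_exp_half_log hb ha]

/-! ### Gaussian entries -/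

lemma isProbabilityMeasure_z2Law (τ : ℝ) (s : ℤˣ) : IsProbabilityMeasure (z2Law τ s) := by
  unfold z2Law; infer_instance

/-- The reference law is the centred Gaussian with tilt `x / τ²`; expanding the square with `s² = 1`
produces the constant. -/
lemma isExpTilt_z2Law {τ : ℝ} (hτ : 0 < τ) :
    IsExpTilt (z2Law τ) (Real.exp (-z2SNR τ)) (2 * z2SNR τ) := by
  have hv : (τ ^ 2).toNNReal ≠ 0 := by simp [hτ.ne']
  have hvc : (((τ ^ 2).toNNReal : NNReal) : ℝ) = τ ^ 2 := Real.coe_toNNReal _ (by positivity)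
  refine ⟨gaussianReal 0 (τ ^ 2).toNNReal, inferInstance, fun x => (τ ^ 2)⁻¹ * x, by fun_prop,
    (memLp_id_gaussianReal 2).const_mul _, le_of_eq ?_, fun s => ?_⟩
  · have h := variance_eq_sub (memLp_id_gaussianReal (μ := 0) (v := (τ ^ 2).toNNReal) 2)
    rw [variance_id_gaussianReal, hvc] at h
    simp only [Pi.pow_apply, id, integral_id_gaussianReal] at h
    simp only [mul_pow, integral_const_mul, z2SNR]
    rw [show ∫ x, x ^ 2 ∂gaussianReal 0 (τ ^ 2).toNNReal = τ ^ 2 by linarith]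
    field_simp
  · unfold z2Law
    rw [gaussianReal_of_var_ne_zero _ hv, gaussianReal_of_var_ne_zero _ hv,
      ← withDensity_mul _ (measurable_gaussianPDF _ _) (by fun_prop)]
    congr 1
    ext x
    simp only [Pi.mul_apply, gaussianPDF, gaussianPDFReal, hvc, z2SNR]
    rw [← ENNReal.ofReal_mul (by positivity), ← Real.exp_add,
      mul_assoc (√(2 * Real.pi * τ ^ 2))⁻¹, ← Real.exp_add]
    congr 3
    have := sq_intUnit s
    field_simp
    linear_combination -this

/-! ### Censored entries -/

lemma isProbabilityMeasure_cbmLaw {α ε : ℝ} (hα : 0 < α) (hα1 : α ≤ 1) (hε : 0 < ε)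
    (hε1 : ε < 1 / 2) (s : ℤˣ) : IsProbabilityMeasure (cbmLaw α ε s) := by
  refine ⟨?_⟩
  have h1 : 0 ≤ α * (1 - ε) := mul_nonneg hα.le (by linarith)
  have h2 : 0 ≤ α * ε := by positivity
  simp only [cbmLaw, Measure.add_apply, Measure.smul_apply, measure_univ, smul_eq_mul, mul_one]
  rw [← ENNReal.ofReal_add h1 h2, ← ENNReal.ofReal_add (by linarith) (by linarith),
    ← ENNReal.ofReal_one]
  congr 1
  ring

/-- Identifies `1 - I*` as the Bhattacharyya coefficient of the two censored laws. -/
lemma one_sub_cbmSNR {α ε : ℝ} (hα : 0 ≤ α) (hε : 0 < ε) (hε1 : ε < 1 / 2) :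
    1 - cbmSNR α ε = 2 * √(α * (1 - ε) * (α * ε)) + (1 - α) := by
  have h1 : 0 ≤ α * (1 - ε) := mul_nonneg hα (by linarith)
  have h2 : 0 ≤ α * ε := by positivity
  rw [cbmSNR, sub_sq, Real.sq_sqrt h1, Real.sq_sqrt h2, Real.sqrt_mul h1]
  ring

lemma isExpTilt_cbmLaw {α ε : ℝ} (hα : 0 < α) (hα1 : α ≤ 1) (hε : 0 < ε) (hε1 : ε < 1 / 2) :
    IsExpTilt (cbmLaw α ε) (1 - cbmSNR α ε)
      (2 * √(α * (1 - ε) * (α * ε)) / (1 - cbmSNR α ε) *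
        (1 / 2 * Real.log (α * (1 - ε) / (α * ε))) ^ 2) := by
  rw [one_sub_cbmSNR hα.le hε hε1]
  have ha : 0 < α * (1 - ε) := mul_pos hα (by linarith)
  have hb : 0 < α * ε := by positivity
  have e1 := sqrt_mul_mul_exp_half_log ha hb
  have e2 := sqrt_mul_mul_exp_neg_half_log ha hb
  set w := √(α * (1 - ε) * (α * ε)) with hw
  set l := 1 / 2 * Real.log (α * (1 - ε) / (α * ε)) with hl
  have hw0 : 0 < w := Real.sqrt_pos.2 (by positivity)
  set B := 2 * w + (1 - α) with hBdef
  have hB : 0 < B := by linarith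
  have h1α : 0 ≤ (1 - α) / B := div_nonneg (by linarith) hB.le
  have hwB : 0 ≤ w / B := by positivity
  set r : Measure ℝ := ENNReal.ofReal (w / B) • Measure.dirac 1 +
    ENNReal.ofReal (w / B) • Measure.dirac (-1) + ENNReal.ofReal ((1 - α) / B) • Measure.dirac 0
    with hr
  have hrp : IsProbabilityMeasure r := by
    refine ⟨?_⟩
    simp only [hr, Measure.add_apply, Measure.smul_apply, measure_univ, smul_eq_mul, mul_one]
    rw [← ENNReal.ofReal_add hwB hwB, ← ENNReal.ofReal_add (by positivity) h1α,
      ← ENNReal.ofReal_one]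
    congr 1
    rw [← add_div, ← add_div, ← two_mul, ← hBdef, div_self hB.ne']
  have hdirac : ∀ (c x : ℝ) (g : ℝ → ℝ), Integrable g (ENNReal.ofReal c • Measure.dirac x) :=
    fun c x g => (integrable_dirac (by simp)).smul_measure ENNReal.ofReal_ne_top
  refine ⟨r, hrp, fun x => l * x, by fun_prop, ?_, le_of_eq ?_, fun s => ?_⟩
  · rw [memLp_two_iff_integrable_sq (by fun_prop)]
    exact ((hdirac _ _ _).add_measure (hdirac _ _ _)).add_measure (hdirac _ _ _)
  · rw [integral_add_measure ((hdirac _ _ _).add_measure (hdirac _ _ _)) (hdirac _ _ _),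
      integral_add_measure (hdirac _ _ _) (hdirac _ _ _)]
    simp only [integral_smul_measure, integral_dirac, ENNReal.toReal_ofReal hwB,
      ENNReal.toReal_ofReal h1α, smul_eq_mul]
    ring
  · rw [hr, withDensity_add_measure, withDensity_add_measure, withDensity_smul_measure,
      withDensity_smul_measure, withDensity_smul_measure, dirac_withDensity, dirac_withDensity,
      dirac_withDensity, smul_smul, smul_smul, smul_smul, ← ENNReal.ofReal_mul hwB,
      ← ENNReal.ofReal_mul hwB, ← ENNReal.ofReal_mul h1α]
    have c1 : w / B * (B * Real.exp l) = α * (1 - ε) := by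
      rw [← e1]; field_simp
    have c2 : w / B * (B * Real.exp (-l)) = α * ε := by
      rw [← e2]; field_simp
    have c3 : (1 - α) / B * B = 1 - α := div_mul_cancel₀ _ hB.ne'
    rcases Int.units_eq_one_or s with rfl | rfl
    · simp [cbmLaw, c1, c2, c3]
    · simp [cbmLaw, c1, c2, c3, add_comm]

/-! ### Bernoulli entries and the balanced parameter space -/

lemma bernoulliMeasure_eq_ofReal (p : unitInterval) :
    bernoulliMeasure (1 : ℝ) 0 p = ENNReal.ofReal p • Measure.dirac 1 +
      ENNReal.ofReal (1 - p) • Measure.dirac 0 := by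
  rw [bernoulliMeasure_def]
  congr 1
  · congr 1
    exact (Real.toNNReal_of_nonneg p.2.1).symm
  · congr 1
    exact (Real.toNNReal_of_nonneg (sub_nonneg.2 p.2.2)).symm

lemma isProbabilityMeasure_sbmLaw (p q : unitInterval) (s : ℤˣ) :
    IsProbabilityMeasure (sbmLaw p q s) := by
  unfold sbmLaw; split_ifs <;> infer_instance

/-- The Bhattacharyya coefficient of two Bernoulli laws. -/
def bernoulliAffinity (p q : ℝ) : ℝ := √(p * q) + √((1 - p) * (1 - q))

/-- With `u = log (a / b) / 2` one has `(a - b)² = 4ab sinh² u`, and `|u| ≤ |sinh u|`. -/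
lemma sub_sq_ge_mul_log_div_sq {a b : ℝ} (ha : 0 < a) (hb : 0 < b) :
    a * b * Real.log (a / b) ^ 2 ≤ (a - b) ^ 2 := by
  set u := Real.log (a / b) / 2 with hu
  have h1 : u ^ 2 ≤ Real.sinh u ^ 2 := by
    rw [sq_le_sq, Real.abs_sinh]
    exact Real.self_le_sinh_iff.2 (abs_nonneg _)
  have h2 : Real.exp u ^ 2 = a / b := by
    rw [← Real.exp_nat_mul, hu]
    push_cast
    rw [mul_div_cancel₀ _ two_ne_zero, Real.exp_log (by positivity)]
  have h3 : a * b * (4 * Real.sinh u ^ 2) = (a - b) ^ 2 := by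
    have he : Real.exp u * Real.exp (-u) = 1 := by rw [← Real.exp_add]; simp
    have h4 : Real.exp (-u) ^ 2 = b / a := by
      rw [Real.exp_neg, inv_pow, h2, inv_div]
    rw [Real.sinh_eq, div_pow, sub_sq, h2, h4, mul_assoc 2, he]
    field_simp
    ring
  calc a * b * Real.log (a / b) ^ 2 = a * b * (4 * u ^ 2) := by rw [hu]; ring
    _ ≤ _ := by rw [← h3]; gcongr

/-- The previous bound at `√x`, `√y`: the second moment of the log-ratio is controlled by the
squared Hellinger distance. -/
lemma sqrt_mul_mul_half_log_sq_le {x y : ℝ} (hx : 0 < x) (hy : 0 < y) :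
    √(x * y) * (1 / 2 * Real.log (x / y)) ^ 2 ≤ x + y - 2 * √(x * y) := by
  have h := sub_sq_ge_mul_log_div_sq (Real.sqrt_pos.2 hx) (Real.sqrt_pos.2 hy)
  rw [← Real.sqrt_mul hx.le, ← Real.sqrt_div hx.le, Real.log_sqrt (by positivity), sub_sq,
    Real.sq_sqrt hx.le, Real.sq_sqrt hy.le, mul_assoc 2, ← Real.sqrt_mul hx.le] at h
  rw [one_div_mul_eq_div]
  linarith

/-- The tilt is the affine function with values `l` at 1 and `l'` at 0. It need not be centred under
`r`, which is why balanced labels are required. -/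
lemma isExpTilt_sbmLaw {p q : unitInterval} (hq : 0 < (q : ℝ)) (hqp : (q : ℝ) < p)
    (hp : (p : ℝ) < 1) :
    IsExpTilt (sbmLaw p q) (bernoulliAffinity p q)
      ((2 - 2 * bernoulliAffinity p q) / bernoulliAffinity p q) := by
  have hp0 : 0 < (p : ℝ) := hq.trans hqp
  have hp1 : 0 < 1 - (p : ℝ) := by linarith
  have hq1 : 0 < 1 - (q : ℝ) := by linarith
  unfold bernoulliAffinity
  have e1 := sqrt_mul_mul_exp_half_log hp0 hq
  have e2 := sqrt_mul_mul_exp_neg_half_log hp0 hq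
  have e3 := sqrt_mul_mul_exp_half_log hp1 hq1
  have e4 := sqrt_mul_mul_exp_neg_half_log hp1 hq1
  have b1 := sqrt_mul_mul_half_log_sq_le hp0 hq
  have b2 := sqrt_mul_mul_half_log_sq_le hp1 hq1
  set w := √((p : ℝ) * q) with hw
  set w' := √((1 - (p : ℝ)) * (1 - q)) with hw'
  set l := 1 / 2 * Real.log ((p : ℝ) / q) with hl
  set l' := 1 / 2 * Real.log ((1 - (p : ℝ)) / (1 - q)) with hl'
  have hw0 : 0 < w := Real.sqrt_pos.2 (by positivity)
  have hw'0 : 0 < w' := Real.sqrt_pos.2 (by positivity)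
  set B := w + w' with hBdef
  have hB : 0 < B := by positivity
  have hwB : 0 ≤ w / B := by positivity
  have hw'B : 0 ≤ w' / B := by positivity
  set r : Measure ℝ := ENNReal.ofReal (w / B) • Measure.dirac 1 +
    ENNReal.ofReal (w' / B) • Measure.dirac 0 with hr
  have hrp : IsProbabilityMeasure r := by
    refine ⟨?_⟩
    simp only [hr, Measure.add_apply, Measure.smul_apply, measure_univ, smul_eq_mul, mul_one]
    rw [← ENNReal.ofReal_add hwB hw'B, ← add_div, ← hBdef, div_self hB.ne', ENNReal.ofReal_one]
  have hdirac : ∀ (c x : ℝ) (g : ℝ → ℝ), Integrable g (ENNReal.ofReal c • Measure.dirac x) :=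
    fun c x g => (integrable_dirac (by simp)).smul_measure ENNReal.ofReal_ne_top
  refine ⟨r, hrp, fun x => l' + (l - l') * x, by fun_prop, ?_, ?_, fun s => ?_⟩
  · rw [memLp_two_iff_integrable_sq (by fun_prop)]
    exact (hdirac _ _ _).add_measure (hdirac _ _ _)
  · rw [integral_add_measure (hdirac _ _ _) (hdirac _ _ _)]
    simp only [integral_smul_measure, integral_dirac, ENNReal.toReal_ofReal hwB,
      ENNReal.toReal_ofReal hw'B, smul_eq_mul]
    rw [div_mul_eq_mul_div, div_mul_eq_mul_div, ← add_div]
    gcongr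
    rw [mul_one, mul_zero, add_zero, add_sub_cancel]
    linarith
  · rw [hr, withDensity_add_measure, withDensity_smul_measure, withDensity_smul_measure,
      dirac_withDensity, dirac_withDensity, smul_smul, smul_smul, ← ENNReal.ofReal_mul hwB,
      ← ENNReal.ofReal_mul hw'B]
    have c : ∀ v y : ℝ, v / B * (B * y) = v * y := fun v y => by field_simp
    simp only [mul_one, mul_zero, add_zero, add_sub_cancel, c]
    rcases Int.units_eq_one_or s with rfl | rfl
    · simp [sbmLaw, bernoulliMeasure_eq_ofReal, e1, e3]
    · simp [sbmLaw, bernoulliMeasure_eq_ofReal, e2, e4]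

lemma mem_sbmParamSpace {n : ℕ} (hn : 2 ≤ n) {β : ℝ} (hβ : 1 + 2 / (n : ℝ) < β) {σ : Label n}
    (h1 : -1 ≤ ∑ i, (σ i : ℤ)) (h2 : ∑ i, (σ i : ℤ) ≤ 2) : σ ∈ sbmParamSpace n β := by
  rw [sum_eq_two_mul_card_one_sub, Finset.card_univ, Fintype.card_fin] at h1 h2
  have h1' : (-1 : ℝ) ≤ 2 * ((Finset.univ.filter fun i => σ i = 1).card : ℕ) - n := by
    exact_mod_cast h1
  have h2' : 2 * ((Finset.univ.filter fun i => σ i = 1).card : ℕ) - (n : ℝ) ≤ 2 := by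
    exact_mod_cast h2
  have hn' : (2 : ℝ) ≤ n := by exact_mod_cast hn
  have hnβ : (n : ℝ) + 2 < n * β := by
    have := mul_lt_mul_of_pos_left hβ (show (0 : ℝ) < n by linarith)
    rwa [mul_add, mul_one, mul_div_cancel₀ _ (by linarith)] at this
  have hβ1 : 1 < β := lt_of_le_of_lt (le_add_of_nonneg_right (by positivity)) hβ
  refine ⟨?_, by linarith⟩
  rw [div_le_iff₀ (by linarith)]
  -- From `nβ > n + 2` and `(n - 1)(n + 2) ≥ n²` for `n ≥ 2`.
  have h3 : (n : ℝ) ≤ (n - 1) * β := by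
    have h4 : (n : ℝ) * n ≤ n * ((n - 1) * β) := by nlinarith
    exact le_of_mul_le_mul_left h4 (by linarith)
  nlinarith

/-! ### The three models -/

lemma le_minimaxRisk_z2Law {τ : ℕ → ℝ} (hτ : ∀ n, 0 < τ n)
    (h : Tendsto (fun n : ℕ => (n : ℝ) * z2SNR (τ n)) atTop atTop) :
    ∃ ξ : ℕ → ℝ, Tendsto ξ atTop (𝓝 0) ∧ ∀ᶠ n : ℕ in atTop,
      Real.exp (-((1 + ξ n) * ((n : ℝ) * z2SNR (τ n)))) ≤
        minimaxRisk (z2Law (τ n)) (Set.univ : Set (Label n)) := by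
  refine exists_tendsto_zero_le_minimaxRisk (δ := fun _ => 0) (K := 2)
    (fun n => isProbabilityMeasure_z2Law (τ n))
    (Eventually.of_forall fun _ _ _ _ => Set.mem_univ _) h tendsto_const_nhds
    (Eventually.of_forall fun n => isExpTilt_z2Law (hτ n))
    (Eventually.of_forall fun n => ⟨Real.exp_pos _, ?_, ?_⟩)
    (Eventually.of_forall fun n => by linarith)
  · rw [Real.exp_le_one_iff, neg_nonpos, z2SNR]
    positivity
  · rw [Real.log_exp]
    linarith

lemma le_minimaxRisk_cbmLaw {ε : ℝ} (hε : 0 < ε) (hε1 : ε < 1 / 2) {α : ℕ → ℝ}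
    (hα : ∀ n, 0 < α n ∧ α n ≤ 1)
    (h0 : Tendsto (fun n : ℕ => cbmSNR (α n) ε) atTop (𝓝 0))
    (h : Tendsto (fun n : ℕ => (n : ℝ) * cbmSNR (α n) ε) atTop atTop) :
    ∃ ξ : ℕ → ℝ, Tendsto ξ atTop (𝓝 0) ∧ ∀ᶠ n : ℕ in atTop,
      Real.exp (-((1 + ξ n) * ((n : ℝ) * cbmSNR (α n) ε))) ≤
        minimaxRisk (cbmLaw (α n) ε) (Set.univ : Set (Label n)) := by
  have hsmall : ∀ᶠ n in atTop, cbmSNR (α n) ε ≤ 1 / 2 :=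
    h0.eventually_le_const (by norm_num)
  have hpos : ∀ n, 0 ≤ cbmSNR (α n) ε := fun n => sq_nonneg _
  have hscale : ∀ n, cbmSNR (α n) ε = α n * (√(1 - ε) - √ε) ^ 2 := fun n => by
    rw [cbmSNR, Real.sqrt_mul (hα n).1.le, Real.sqrt_mul (hα n).1.le, ← mul_sub, mul_pow,
      Real.sq_sqrt (hα n).1.le]
  have hgap : 0 < (√(1 - ε) - √ε) ^ 2 :=
    pow_pos (sub_pos.2 (Real.sqrt_lt_sqrt hε.le (by linarith))) 2
  -- For `I ≤ 1/2`, `-log (1 - I) ≤ (1 + 2I) I` gives `δ`. The SNR and the numerator of the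
  -- second-moment bound are linear in `α`; `K` is their ratio, doubled because `1 / (1 - I) ≤ 2`.
  refine exists_tendsto_zero_le_minimaxRisk (δ := fun n => 2 * cbmSNR (α n) ε)
    (K := 4 * √((1 - ε) * ε) * (1 / 2 * Real.log ((1 - ε) / ε)) ^ 2 / (√(1 - ε) - √ε) ^ 2)
    (fun n => isProbabilityMeasure_cbmLaw (hα n).1 (hα n).2 hε hε1)
    (Eventually.of_forall fun _ _ _ _ => Set.mem_univ _) h (by simpa using h0.const_mul 2)
    (Eventually.of_forall fun n => isExpTilt_cbmLaw (hα n).1 (hα n).2 hε hε1) ?_ ?_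
  · filter_upwards [hsmall] with n hn
    have hI := hpos n
    generalize cbmSNR (α n) ε = I at hn hI
    have hB : 0 < 1 - I := by linarith
    refine ⟨hB, by linarith, ?_⟩
    have h1 : -Real.log (1 - I) ≤ (1 + 2 * I) * I := by
      have h2 := Real.one_sub_inv_le_log_of_pos hB
      have h3 : (1 - I)⁻¹ ≤ 1 + (1 + 2 * I) * I := by
        rw [inv_le_iff_one_le_mul₀ hB]
        nlinarith [mul_nonneg (sq_nonneg I) (show 0 ≤ 1 - 2 * I by linarith)]
      linarith
    calc -(n * Real.log (1 - I)) = n * -Real.log (1 - I) := by ring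
      _ ≤ n * ((1 + 2 * I) * I) := by gcongr
      _ = _ := by ring
  · filter_upwards [hsmall] with n hn
    have hαn := (hα n).1
    have hB : (1 : ℝ) / 2 ≤ 1 - cbmSNR (α n) ε := by linarith
    have hw : √(α n * (1 - ε) * (α n * ε)) = α n * √((1 - ε) * ε) := by
      rw [show α n * (1 - ε) * (α n * ε) = α n ^ 2 * ((1 - ε) * ε) by ring,
        Real.sqrt_mul (sq_nonneg _), Real.sqrt_sq hαn.le]
    rw [hw, mul_div_mul_left _ _ hαn.ne']
    set l := (1 / 2 * Real.log ((1 - ε) / ε)) ^ 2 with hl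
    have hl0 : 0 ≤ l := sq_nonneg _
    set w := √((1 - ε) * ε) with hwdef
    have hK : 4 * w * l / (√(1 - ε) - √ε) ^ 2 * (n * cbmSNR (α n) ε) =
        n * (4 * (α n * w) * l) := by
      rw [hscale]
      generalize (√(1 - ε) - √ε) ^ 2 = G at hgap
      field_simp
    rw [hK]
    gcongr
    rw [div_le_iff₀ (by linarith)]
    have : 0 ≤ α n * w := by positivity
    nlinarith

lemma bernoulliAffinity_le_one {p q : ℝ} (hp : 0 ≤ p) (hp1 : p ≤ 1) (hq : 0 ≤ q) (hq1 : q ≤ 1) :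
    bernoulliAffinity p q ≤ 1 := by
  have key : ∀ {a b : ℝ}, 0 ≤ a → 0 ≤ b → √(a * b) ≤ (a + b) / 2 := fun {a b} ha hb => by
    rw [Real.sqrt_le_left (by positivity)]
    nlinarith [sq_nonneg (a - b)]
  have h1 := key hp hq
  have h2 := key (sub_nonneg.2 hp1) (sub_nonneg.2 hq1)
  unfold bernoulliAffinity
  linarith

/-- Here `log B = -I* / 2` exactly, which accounts for `n / 2` and `δ = 0`. The gap `p < 1 - c`
keeps `B ≥ c`, so the second moment is at most `I* / c`. -/
lemma le_minimaxRisk_sbmLaw {c : ℝ} (hc : 0 < c) {p q : ℕ → unitInterval} {β : ℕ → ℝ}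
    (hpq : ∀ n, 0 < (q n : ℝ) ∧ (q n : ℝ) < p n ∧ (p n : ℝ) < 1 - c)
    (hβ : ∀ n : ℕ, 1 + 2 / (n : ℝ) < β n)
    (h : Tendsto (fun n : ℕ => (n : ℝ) * sbmSNR (p n) (q n)) atTop atTop) :
    ∃ ξ : ℕ → ℝ, Tendsto ξ atTop (𝓝 0) ∧ ∀ᶠ n : ℕ in atTop,
      Real.exp (-((1 + ξ n) * ((n : ℝ) / 2 * sbmSNR (p n) (q n)))) ≤
        minimaxRisk (sbmLaw (p n) (q n)) (sbmParamSpace n (β n)) := by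
  have hΛ : Tendsto (fun n : ℕ => (n : ℝ) / 2 * sbmSNR (p n) (q n)) atTop atTop := by
    refine (h.atTop_div_const two_pos).congr fun n => ?_
    ring
  have hB0 : ∀ n, 0 < bernoulliAffinity (p n) (q n) := fun n => by
    have h1 : 0 < √((p n : ℝ) * q n) :=
      Real.sqrt_pos.2 (mul_pos ((hpq n).1.trans (hpq n).2.1) (hpq n).1)
    have := Real.sqrt_nonneg ((1 - (p n : ℝ)) * (1 - q n))
    unfold bernoulliAffinity
    linarith
  have hBc : ∀ n, c ≤ bernoulliAffinity (p n) (q n) := fun n => by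
    have h1 : c ≤ √((1 - (p n : ℝ)) * (1 - q n)) := by
      obtain ⟨-, h2, h3⟩ := hpq n
      refine Real.le_sqrt_of_sq_le ?_
      nlinarith
    have := Real.sqrt_nonneg ((p n : ℝ) * q n)
    unfold bernoulliAffinity
    linarith
  have hSNR : ∀ n, sbmSNR (p n) (q n) = -2 * Real.log (bernoulliAffinity (p n) (q n)) :=
    fun _ => rfl
  refine exists_tendsto_zero_le_minimaxRisk (δ := fun _ => 0) (K := 2 / c)
    (fun n => isProbabilityMeasure_sbmLaw (p n) (q n)) ?_ hΛ tendsto_const_nhds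
    (Eventually.of_forall fun n => isExpTilt_sbmLaw (hpq n).1 (hpq n).2.1 ?_)
    (Eventually.of_forall fun n => ⟨hB0 n, ?_, ?_⟩) (Eventually.of_forall fun n => ?_)
  · filter_upwards [eventually_ge_atTop 2] with n hn σ h1 h2 using mem_sbmParamSpace hn (hβ n) h1 h2
  · linarith [(hpq n).2.2]
  · exact bernoulliAffinity_le_one (p n).2.1 (p n).2.2 (q n).2.1 (q n).2.2
  · rw [hSNR]
    linarith
  · have h1 := Real.log_le_sub_one_of_pos (hB0 n)
    have hI : 2 - 2 * bernoulliAffinity (p n) (q n) ≤ sbmSNR (p n) (q n) := by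
      rw [hSNR]; linarith
    have h2 : 0 ≤ 2 - 2 * bernoulliAffinity (p n) (q n) := by
      linarith [bernoulliAffinity_le_one (p n).2.1 (p n).2.2 (q n).2.1 (q n).2.2]
    calc (n : ℝ) * ((2 - 2 * bernoulliAffinity (p n) (q n)) / bernoulliAffinity (p n) (q n))
        ≤ n * (sbmSNR (p n) (q n) / c) := by
          gcongr
          · exact h2.trans hI
          · exact hBc n
      _ = _ := by ring

end BlockModel

end

theorem theorem1 :
    -- Z2 synchronization
    (∀ τ : ℕ → ℝ, (∀ n, 0 < τ n) →
      Tendsto (fun n : ℕ => (n : ℝ) * BlockModel.z2SNR (τ n)) atTop atTop →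
      ∃ ξ : ℕ → ℝ, Tendsto ξ atTop (𝓝 0) ∧ ∀ᶠ n : ℕ in atTop,
        BlockModel.minimaxRisk (BlockModel.z2Law (τ n)) (Set.univ : Set (BlockModel.Label n)) ≥
          Real.exp (-((1 + ξ n) * (n : ℝ) * BlockModel.z2SNR (τ n)))) ∧
    -- Censored block model
    (∀ ε : ℝ, 0 < ε → ε < 1 / 2 → ∀ α : ℕ → ℝ, (∀ n, 0 < α n ∧ α n ≤ 1) →
      Tendsto (fun n : ℕ => BlockModel.cbmSNR (α n) ε) atTop (𝓝 0) →
      Tendsto (fun n : ℕ => (n : ℝ) * BlockModel.cbmSNR (α n) ε) atTop atTop →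
      ∃ ξ : ℕ → ℝ, Tendsto ξ atTop (𝓝 0) ∧ ∀ᶠ n : ℕ in atTop,
        BlockModel.minimaxRisk (BlockModel.cbmLaw (α n) ε)
            (Set.univ : Set (BlockModel.Label n)) ≥
          Real.exp (-((1 + ξ n) * (n : ℝ) * BlockModel.cbmSNR (α n) ε))) ∧
    -- Binary stochastic block model
    (∃ C : ℝ, 0 < C ∧ ∀ c₀ : ℝ, 0 < c₀ → c₀ < 1 →
      ∀ (p q : ℕ → unitInterval) (β : ℕ → ℝ),
      (∀ n, 0 < (q n : ℝ) ∧ (q n : ℝ) < p n ∧ (p n : ℝ) < 1 - c₀) →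
      (∀ n : ℕ, 1 + C / (n : ℝ) < β n) →
      Tendsto (fun n : ℕ => (n : ℝ) * BlockModel.sbmSNR (p n) (q n)) atTop atTop →
      ∃ ξ : ℕ → ℝ, Tendsto ξ atTop (𝓝 0) ∧ ∀ᶠ n : ℕ in atTop,
        BlockModel.minimaxRisk (BlockModel.sbmLaw (p n) (q n))
            (BlockModel.sbmParamSpace n (β n)) ≥
          Real.exp (-((1 + ξ n) * ((n : ℝ) / 2) * BlockModel.sbmSNR (p n) (q n)))) := by
  refine ⟨fun τ hτ h => ?_, fun ε hε hε1 α hα h0 h => ?_,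
    2, two_pos, fun c hc _ p q β hpq hβ h => ?_⟩
  · simpa only [ge_iff_le, mul_assoc] using BlockModel.le_minimaxRisk_z2Law hτ h
  · simpa only [ge_iff_le, mul_assoc] using BlockModel.le_minimaxRisk_cbmLaw hε hε1 hα h0 h
  · simpa only [ge_iff_le, mul_assoc] using BlockModel.le_minimaxRisk_sbmLaw hc hpq hβ h
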